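/- Let $(X,\mu)$ and $(Y,\nu)$ be standard Borel spaces with $\sigma$-finite measures. A subset of $X\times Y$ is *marginally null* if it is contained in $(X_1\times Y)\cup(X\times Y_1)$ with $\mu(X_1)=\nu(Y_1)=0$, and "m.a.e." means off a marginally null set. A set is *pseudo-open* if, modulo a marginally null set, it is a countable union of measurable rectangles; complements of pseudo-open sets are *pseudo-closed*. Let $\Gamma=L_2(X,\mu)\hat\otimes L_2(Y,\nu)$ be the space of functions $F:X\times Y\to\mathbb C$, identified when equal m.a.e., such that $F(x,y)=\sum_{n} f_n(x)g_n(y)$ m.a.e. with $f_n\in L_2(X,\mu)$, $g_n\in L_2(Y,\nu)$ and $\sum_n\|f_n\|_2\|g_n\|_2<\infty$; $\|F\|_\Gamma$ is the infimum of these sums over all such representations. A function vanishes on a set if it is zero m.a.e. on it. For $K\subseteq X\times Y$ let $\Phi(K)$ be the set of $F\in\Gamma$ vanishing on $K$, and let $\Phi_0(K)$ be the $\|\cdot\|_\Gamma$-closure of the set of $F\in\Gamma$ vanishing on some pseudo-open set containing $K$. A pseudo-closed set $K$ is *$\mu\times\nu$-synthetic* if $\Phi_0(K)=\Phi(K)$.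 Let $V^\infty$ be the set of functions $w$ with $w(x,y)=\sum_i\varphi_i(x)\psi_i(y)$ m.a.e., where $\varphi_i\in L^\infty(X,\mu)$, $\psi_i\in L^\infty(Y,\nu)$ and $\sum_i|\varphi_i|^2$, $\sum_i|\psi_i|^2$ converge almost everywhere to functions in $L^\infty(X,\mu)$, $L^\infty(Y,\nu)$. A pseudo-closed set $E$ is *$\mu\times\nu$-Ditkin* if for every $f\in\Phi(E)$ there are $g_n\in V^\infty$, each vanishing on some pseudo-open set containing $E$, with $\|g_nf-f\|_\Gamma\to0$. **Theorem.** Let $E_1,E_2\subseteq X\times Y$ be pseudo-closed sets whose intersection $E_1\cap E_2$ is $\mu\times\nu$-Ditkin. Then $E_1\cup E_2$ is $\mu\times\nu$-synthetic if and only if both $E_1$ and $E_2$ are $\mu\times\nu$-synthetic. Moreover, $\Phi_0(E_1\cup E_2)=\Phi_0(E_1)\cap\Phi_0(E_2)$. -/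

import Mathlib

open MeasureTheory Filter Topology
open scoped ENNReal

namespace OpSynth

section Defs

variable {X Y : Type*} [MeasurableSpace X] [MeasurableSpace Y]

/-- `E ⊆ (X₁ × Y) ∪ (X × Y₁)` for some `μ`-null set `X₁` and some `ν`-null set `Y₁`. -/
def MarginallyNull (μ : Measure X) (ν : Measure Y) (E : Set (X × Y)) : Prop :=
  ∃ (X₁ : Set X) (Y₁ : Set Y), μ X₁ = 0 ∧ ν Y₁ = 0 ∧
    E ⊆ (X₁ ×ˢ Set.univ) ∪ (Set.univ ×ˢ Y₁)

/-- The property `P` holds marginally almost everywhere (m.a.e.). -/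
def MarginallyAE (μ : Measure X) (ν : Measure Y) (P : X × Y → Prop) : Prop :=
  MarginallyNull μ ν {p | ¬ P p}

/-- Pseudo-open sets: modulo a marginally null set, a countable union of measurable
rectangles. -/
def PseudoOpen (μ : Measure X) (ν : Measure Y) (U : Set (X × Y)) : Prop :=
  ∃ (A : ℕ → Set X) (B : ℕ → Set Y), (∀ n, MeasurableSet (A n)) ∧ (∀ n, MeasurableSet (B n)) ∧
    MarginallyNull μ ν (symmDiff U (⋃ n, A n ×ˢ B n))

/-- Pseudo-closed sets: complements of pseudo-open sets. -/
def PseudoClosed (μ : Measure X) (ν : Measure Y) (E : Set (X × Y)) : Prop :=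
  PseudoOpen μ ν Eᶜ

/-- `F(x,y) = ∑ₙ fₙ(x) gₙ(y)` m.a.e., with `fₙ ∈ L₂(X,μ)` and `gₙ ∈ L₂(Y,ν)`. -/
structure IsL2Rep (μ : Measure X) (ν : Measure Y) (F : X × Y → ℂ)
    (f : ℕ → X → ℂ) (g : ℕ → Y → ℂ) : Prop where
  memLp_left : ∀ n, MemLp (f n) 2 μ
  memLp_right : ∀ n, MemLp (g n) 2 ν
  hasSum : MarginallyAE μ ν fun p => HasSum (fun n => f n p.1 * g n p.2) (F p)

/-- The projective tensor norm `inf ∑ₙ ‖fₙ‖₂ ‖gₙ‖₂` over all representations of `F`, as an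
extended number. It is `∞` exactly when `F` has no representation with a finite sum. -/
noncomputable def gammaNorm (μ : Measure X) (ν : Measure Y) (F : X × Y → ℂ) : ℝ≥0∞ :=
  ⨅ (f : ℕ → X → ℂ) (g : ℕ → Y → ℂ) (_ : IsL2Rep μ ν F f g),
    ∑' n, eLpNorm (f n) 2 μ * eLpNorm (g n) 2 ν

/-- `Γ(X,Y) = L₂(X,μ) ⊗̂ L₂(Y,ν)` as a space of functions. Functions that agree m.a.e. are the
same element of `Γ(X,Y)`; all the sets of functions below are unions of such classes, so that
equality of these sets is the same as equality of the corresponding sets of classes. -/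
def Gamma (μ : Measure X) (ν : Measure Y) : Set (X × Y → ℂ) :=
  {F | gammaNorm μ ν F < ∞}

/-- Closure of `S` in the norm of `Γ(X,Y)`. -/
def gammaClosure (μ : Measure X) (ν : Measure Y) (S : Set (X × Y → ℂ)) : Set (X × Y → ℂ) :=
  {F | F ∈ Gamma μ ν ∧ ∀ ε : ℝ≥0∞, 0 < ε → ∃ G ∈ S, gammaNorm μ ν (F - G) < ε}

/-- `F` vanishes on `K`, that is, `F χ_K = 0` m.a.e. -/
def VanishesOn (μ : Measure X) (ν : Measure Y) (F : X × Y → ℂ) (K : Set (X × Y)) : Prop :=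
  MarginallyAE μ ν fun p => p ∈ K → F p = 0

/-- `F` vanishes on a neighbourhood of `K`, that is, on a pseudo-open set containing `K`. -/
def VanishesNear (μ : Measure X) (ν : Measure Y) (F : X × Y → ℂ) (K : Set (X × Y)) : Prop :=
  ∃ U, PseudoOpen μ ν U ∧ K ⊆ U ∧ VanishesOn μ ν F U

/-- `Φ(K)`: the elements of `Γ(X,Y)` that vanish on `K`. -/
def Phi (μ : Measure X) (ν : Measure Y) (K : Set (X × Y)) : Set (X × Y → ℂ) :=
  {F | F ∈ Gamma μ ν ∧ VanishesOn μ ν F K}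

/-- `Φ₀(K)`: the closure in `Γ(X,Y)` of the elements that vanish on a neighbourhood of `K`. -/
def PhiZero (μ : Measure X) (ν : Measure Y) (K : Set (X × Y)) : Set (X × Y → ℂ) :=
  gammaClosure μ ν {F | F ∈ Gamma μ ν ∧ VanishesNear μ ν F K}

/-- `μ × ν`-synthetic sets. -/
def Synthetic (μ : Measure X) (ν : Measure Y) (K : Set (X × Y)) : Prop :=
  PseudoClosed μ ν K ∧ PhiZero μ ν K = Phi μ ν K

/-- `V^∞(X,Y)`: the functions `w` with `w(x,y) = ∑ᵢ φᵢ(x) ψᵢ(y)` m.a.e., where `φᵢ` and `ψᵢ` are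
essentially bounded and the series `∑ᵢ |φᵢ|²`, `∑ᵢ |ψᵢ|²` converge almost everywhere to
essentially bounded functions. -/
def VInfty (μ : Measure X) (ν : Measure Y) : Set (X × Y → ℂ) :=
  {w | ∃ (φ : ℕ → X → ℂ) (ψ : ℕ → Y → ℂ),
    (∀ i, MemLp (φ i) ∞ μ) ∧ (∀ i, MemLp (ψ i) ∞ ν) ∧
    (∃ a : X → ℝ, MemLp a ∞ μ ∧ ∀ᵐ x ∂μ, HasSum (fun i => ‖φ i x‖ ^ 2) (a x)) ∧
    (∃ b : Y → ℝ, MemLp b ∞ ν ∧ ∀ᵐ y ∂ν, HasSum (fun i => ‖ψ i y‖ ^ 2) (b y)) ∧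
    MarginallyAE μ ν fun p => HasSum (fun i => φ i p.1 * ψ i p.2) (w p)}

/-- `Ψ₀₀(E)`: the elements of `V^∞(X,Y)` that vanish on a neighbourhood of `E`. -/
def PsiZeroZero (μ : Measure X) (ν : Measure Y) (E : Set (X × Y)) : Set (X × Y → ℂ) :=
  {w | w ∈ VInfty μ ν ∧ VanishesNear μ ν w E}

/-- `μ × ν`-Ditkin sets: every `f ∈ Φ(E)` is a limit in `Γ(X,Y)` of products `gₙ f` with
`gₙ ∈ Ψ₀₀(E)`. -/
def Ditkin (μ : Measure X) (ν : Measure Y) (E : Set (X × Y)) : Prop :=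
  PseudoClosed μ ν E ∧ ∀ f ∈ Phi μ ν E, ∃ g : ℕ → X × Y → ℂ,
    (∀ n, g n ∈ PsiZeroZero μ ν E) ∧
    Tendsto (fun n => gammaNorm μ ν (g n * f - f)) atTop (𝓝 0)

end Defs

end OpSynth

/-!
In a regular Banach algebra on a compact space, a union is shown to be synthetic by a partition of
unity: after multiplication by a function that vanishes near `E₁ ∩ E₂`, which the Ditkin condition
permits, only the disjoint closed sets `E₁ \ U` and `E₂ \ U` matter, and these have disjoint
neighbourhoods. The same idea works for the pseudo-topology of `X × Y`, with the following
substitutes.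

* Compactness. In suitable Polish topologies on `X` and `Y` countably many given rectangles are
  open, and the measures are carried by countable unions of compact sets. Hence a countable cover
  of `X × Y` by rectangles has a finite subcover on rectangles `P k ×ˢ Q k` that exhaust `X × Y`
  (`exists_exhaustion_finite_cover`), and restriction to these rectangles converges to the identity
  strongly on `Γ` (`tendsto_gammaNorm_indicator_compl_mul`).
* Separation. Applied to the rectangles that make up `U`, `E₁ᶜ` and `E₂ᶜ`, this gives a finite
  union `W` of rectangles that misses `E₂` and contains, within `P k ×ˢ Q k`, all of `E₁ \ U`,
  both up to marginally null sets (`exists_separation`). The indicator of `W` is a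
  multiplier of `Γ`, as is every element of `V^∞` (`IsMultiplier.of_mem_VInfty`).

So every `F ∈ Φ(E₁ ∩ E₂)` is a limit of sums `m₁ F + m₂ F` with multipliers `m₁` vanishing near `E₂`
and `m₂` vanishing near `E₁` (`Ditkin.exists_multipliers`). If `F ∈ Φ₀(E₁) ∩ Φ₀(E₂)`, both summands
are in `Φ₀(E₁ ∪ E₂)`. If `F ∈ Φ(E₁)`, then `m₁ F ∈ Φ(E₁ ∪ E₂)` and `m₂ F ∈ Φ₀(E₁)`. The two formulas
`Φ₀(E₁ ∪ E₂) = Φ₀(E₁) ∩ Φ₀(E₂)` and `Φ(E₁ ∪ E₂) = Φ(E₁) ∩ Φ(E₂)`, together with `Φ₀ ⊆ Φ`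
(`VanishesOn.of_approx`), give the theorem.
-/

namespace OpSynth

open scoped NNReal

variable {X Y : Type*} [MeasurableSpace X] [MeasurableSpace Y] {μ : Measure X} {ν : Measure Y}

/-! ### Marginally almost everywhere -/



/-- The m.a.e. quantifier is the filter quantifier of `ae μ ×ˢ ae ν`; in particular it is stable
under countable intersections. -/
theorem marginallyAE_iff {P : X × Y → Prop} :
    MarginallyAE μ ν P ↔ ∀ᶠ p in ae μ ×ˢ ae ν, P p := by
  rw [eventually_prod_iff]
  constructor
  · rintro ⟨A, B, hA, hB, h⟩
    refine ⟨fun x => x ∉ A, measure_eq_zero_iff_ae_notMem.1 hA, fun y => y ∉ B,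
      measure_eq_zero_iff_ae_notMem.1 hB, fun {x} hx {y} hy => ?_⟩
    by_contra hP
    rcases h (show (x, y) ∈ {p | ¬ P p} from hP) with h | h
    · exact hx h.1
    · exact hy h.2
  · rintro ⟨p, hp, q, hq, h⟩
    refine ⟨{x | ¬ p x}, {y | ¬ q y}, hp, hq, ?_⟩
    rintro ⟨x, y⟩ hxy
    by_cases hx : p x
    · exact Or.inr ⟨trivial, fun hy => hxy (h hx hy)⟩
    · exact Or.inl ⟨hx, trivial⟩

theorem marginallyNull_iff {E : Set (X × Y)} :
    MarginallyNull μ ν E ↔ ∀ᶠ p in ae μ ×ˢ ae ν, p ∉ E := by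
  rw [← marginallyAE_iff, MarginallyAE]
  simp

instance : CountableInterFilter (ae μ ×ˢ ae ν) := by
  rw [Filter.prod_eq_inf]
  infer_instance

/-! ### Pseudo-open sets -/

theorem PseudoOpen.of_countable {ι : Type*} [Countable ι] [Nonempty ι] {U : Set (X × Y)}
    (A : ι → Set X) (B : ι → Set Y) (hA : ∀ i, MeasurableSet (A i))
    (hB : ∀ i, MeasurableSet (B i))
    (h : ∀ᶠ p in ae μ ×ˢ ae ν, p ∈ U ↔ ∃ i, p.1 ∈ A i ∧ p.2 ∈ B i) : PseudoOpen μ ν U := by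
  obtain ⟨f, hf⟩ := exists_surjective_nat ι
  refine ⟨A ∘ f, B ∘ f, fun n => hA _, fun n => hB _, marginallyNull_iff.2 ?_⟩
  filter_upwards [h] with p hp
  simp only [Set.mem_symmDiff, Set.mem_iUnion, Set.mem_prod, Function.comp_apply,
    ← hf.exists (p := fun i => p.1 ∈ A i ∧ p.2 ∈ B i), hp, and_not_self, or_self,
    not_false_eq_true]

theorem PseudoOpen.exists_rectangles {U : Set (X × Y)} (hU : PseudoOpen μ ν U) :
    ∃ (A : ℕ → Set X) (B : ℕ → Set Y), (∀ n, MeasurableSet (A n)) ∧ (∀ n, MeasurableSet (B n)) ∧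
      ∀ᶠ p in ae μ ×ˢ ae ν, p ∈ U ↔ ∃ i, p.1 ∈ A i ∧ p.2 ∈ B i := by
  obtain ⟨A, B, hA, hB, h⟩ := hU
  refine ⟨A, B, hA, hB, ?_⟩
  filter_upwards [marginallyNull_iff.1 h] with p hp
  simp only [Set.mem_symmDiff, Set.mem_iUnion, Set.mem_prod] at hp
  grind

theorem PseudoOpen.congr {U V : Set (X × Y)} (hU : PseudoOpen μ ν U)
    (h : ∀ᶠ p in ae μ ×ˢ ae ν, p ∈ U ↔ p ∈ V) : PseudoOpen μ ν V := by
  obtain ⟨A, B, hA, hB, hAB⟩ := hU.exists_rectangles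
  refine .of_countable A B hA hB ?_
  filter_upwards [h, hAB] with p h₁ h₂
  rw [← h₁, h₂]

theorem PseudoOpen.prod {A : Set X} {B : Set Y} (hA : MeasurableSet A) (hB : MeasurableSet B) :
    PseudoOpen μ ν (A ×ˢ B) :=
  .of_countable (fun _ : Unit => A) (fun _ => B) (fun _ => hA) (fun _ => hB)
    (.of_forall fun p => by simp)

theorem PseudoOpen.union {U V : Set (X × Y)} (hU : PseudoOpen μ ν U) (hV : PseudoOpen μ ν V) :
    PseudoOpen μ ν (U ∪ V) := by
  obtain ⟨A, B, hA, hB, hAB⟩ := hU.exists_rectangles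
  obtain ⟨C, D, hC, hD, hCD⟩ := hV.exists_rectangles
  refine .of_countable (Sum.elim A C) (Sum.elim B D) (Sum.forall.2 ⟨hA, hC⟩)
    (Sum.forall.2 ⟨hB, hD⟩) ?_
  filter_upwards [hAB, hCD] with p h₁ h₂
  simp [h₁, h₂]

theorem PseudoOpen.inter {U V : Set (X × Y)} (hU : PseudoOpen μ ν U) (hV : PseudoOpen μ ν V) :
    PseudoOpen μ ν (U ∩ V) := by
  obtain ⟨A, B, hA, hB, hAB⟩ := hU.exists_rectangles
  obtain ⟨C, D, hC, hD, hCD⟩ := hV.exists_rectangles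
  refine .of_countable (fun i : ℕ × ℕ => A i.1 ∩ C i.2) (fun i => B i.1 ∩ D i.2)
    (fun i => (hA _).inter (hC _)) (fun i => (hB _).inter (hD _)) ?_
  filter_upwards [hAB, hCD] with p h₁ h₂
  simp only [Set.mem_inter_iff, h₁, h₂, Prod.exists]
  constructor
  · rintro ⟨⟨i, hi⟩, j, hj⟩
    exact ⟨i, j, ⟨hi.1, hj.1⟩, hi.2, hj.2⟩
  · rintro ⟨i, j, h, h'⟩
    exact ⟨⟨i, h.1, h'.1⟩, j, h.2, h'.2⟩

theorem PseudoOpen.compl_prod {A : Set X} {B : Set Y} (hA : MeasurableSet A)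
    (hB : MeasurableSet B) : PseudoOpen μ ν (A ×ˢ B)ᶜ := by
  have h := (PseudoOpen.prod (μ := μ) (ν := ν) hA.compl MeasurableSet.univ).union
    (PseudoOpen.prod MeasurableSet.univ hB.compl)
  refine h.congr (.of_forall fun p => ?_)
  simp only [Set.mem_union, Set.mem_prod, Set.mem_compl_iff, Set.mem_univ]
  tauto

theorem PseudoClosed.union {E F : Set (X × Y)} (hE : PseudoClosed μ ν E)
    (hF : PseudoClosed μ ν F) : PseudoClosed μ ν (E ∪ F) := by
  rw [PseudoClosed, Set.compl_union]
  exact hE.inter hF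

/-! ### Vanishing on a set and near a set -/

theorem vanishesOn_iff {F : X × Y → ℂ} {K : Set (X × Y)} :
    VanishesOn μ ν F K ↔ ∀ᶠ p in ae μ ×ˢ ae ν, p ∈ K → F p = 0 :=
  marginallyAE_iff

theorem VanishesOn.mul_right {m : X × Y → ℂ} {K : Set (X × Y)} (h : VanishesOn μ ν m K)
    (F : X × Y → ℂ) : VanishesOn μ ν (m * F) K := by
  rw [vanishesOn_iff] at *
  filter_upwards [h] with p hp hK
  simp [hp hK]

theorem VanishesNear.of_ae_subset {F : X × Y → ℂ} {U K : Set (X × Y)} (hU : PseudoOpen μ ν U)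
    (hKU : ∀ᶠ p in ae μ ×ˢ ae ν, p ∈ K → p ∈ U) (hF : VanishesOn μ ν F U) :
    VanishesNear μ ν F K := by
  refine ⟨U ∪ K, hU.congr ?_, Set.subset_union_right, ?_⟩
  · filter_upwards [hKU] with p hp
    simpa using hp
  · rw [vanishesOn_iff] at *
    filter_upwards [hKU, hF] with p h₁ h₂ h₃
    exact h₂ (h₃.elim id h₁)

theorem VanishesNear.mono {F : X × Y → ℂ} {K L : Set (X × Y)} (h : VanishesNear μ ν F L)
    (hKL : K ⊆ L) : VanishesNear μ ν F K := by
  obtain ⟨U, hU, hLU, hF⟩ := h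
  exact ⟨U, hU, hKL.trans hLU, hF⟩

theorem VanishesNear.vanishesOn {F : X × Y → ℂ} {K : Set (X × Y)} (h : VanishesNear μ ν F K) :
    VanishesOn μ ν F K := by
  obtain ⟨U, hU, hLU, hF⟩ := h
  rw [vanishesOn_iff] at *
  filter_upwards [hF] with p hp hK using hp (hLU hK)

theorem VanishesNear.mul_right {m : X × Y → ℂ} {K : Set (X × Y)} (h : VanishesNear μ ν m K)
    (F : X × Y → ℂ) : VanishesNear μ ν (m * F) K := by
  obtain ⟨U, hU, hKU, hm⟩ := h
  exact ⟨U, hU, hKU, hm.mul_right F⟩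

theorem VanishesNear.mul_left {F : X × Y → ℂ} {K : Set (X × Y)} (h : VanishesNear μ ν F K)
    (m : X × Y → ℂ) : VanishesNear μ ν (m * F) K :=
  mul_comm F m ▸ h.mul_right m

theorem VanishesNear.union {F : X × Y → ℂ} {K L : Set (X × Y)} (hK : VanishesNear μ ν F K)
    (hL : VanishesNear μ ν F L) : VanishesNear μ ν F (K ∪ L) := by
  obtain ⟨U, hU, hKU, hF⟩ := hK
  obtain ⟨V, hV, hLV, hF'⟩ := hL
  refine ⟨U ∪ V, hU.union hV, Set.union_subset_union hKU hLV, ?_⟩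
  rw [vanishesOn_iff] at *
  filter_upwards [hF, hF'] with p h₁ h₂ h₃ using h₃.elim h₁ h₂

theorem VanishesNear.add {F G : X × Y → ℂ} {K : Set (X × Y)} (hF : VanishesNear μ ν F K)
    (hG : VanishesNear μ ν G K) : VanishesNear μ ν (F + G) K := by
  obtain ⟨U, hU, hKU, hF⟩ := hF
  obtain ⟨V, hV, hKV, hG⟩ := hG
  refine ⟨U ∩ V, hU.inter hV, Set.subset_inter hKU hKV, ?_⟩
  rw [vanishesOn_iff] at *
  filter_upwards [hF, hG] with p h₁ h₂ h₃
  simp [h₁ h₃.1, h₂ h₃.2]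

/-! ### The covering lemma -/

/-- A `σ`-finite measure on a standard Borel space is carried by countably many sets which are
compact for a topology in which countably many prescribed measurable sets are open. The compact
sets can be chosen inside a given conull set `S`. -/
theorem exists_topology_compact_exhaustion [StandardBorelSpace X] (μ : Measure X) [SigmaFinite μ]
    {ι : Type*} [Countable ι] (A : ι → Set X) (hA : ∀ i, MeasurableSet (A i))
    {S : Set X} (hS : MeasurableSet S) (hSμ : μ Sᶜ = 0) :
    ∃ (_ : TopologicalSpace X) (K : ℕ → Set X), (∀ i, IsOpen (A i)) ∧ (∀ k, IsCompact (K k)) ∧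
      (∀ k, MeasurableSet (K k)) ∧ Monotone K ∧ (∀ k, K k ⊆ S) ∧ μ (⋃ k, K k)ᶜ = 0 := by
  let := upgradeStandardBorel X
  -- a finer Polish topology has the same Borel sets, so inner regularity holds for it as well
  choose m hm hmP _ hmo using fun i => (hA i).isClopenable
  obtain ⟨t, htm, htle, htP⟩ := PolishSpace.exists_polishSpace_forall_le m hm hmP
  have htB : @BorelSpace X t _ := by
    constructor
    rw [eq_borel_upgradeStandardBorel X, borel_eq_borel_of_le htP _ htle]
    infer_instance
  obtain ⟨ρ, hρ, hμρ, hρμ⟩ := exists_isFiniteMeasure_absolutelyContinuous μ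
  have key : ∀ n : ℕ, ∃ K ⊆ S, (@IsCompact X t K ∧ @IsClosed X t K) ∧
      ρ S < ρ K + ((n : ℝ≥0∞) + 1)⁻¹ := fun n =>
    (@innerRegular_isCompact_isClosed_measurableSet_of_finite X _ t inferInstance inferInstance
      htB ρ hρ).exists_subset_lt_add ⟨@isCompact_empty X t, @isClosed_empty X t⟩ hS
      (measure_ne_top ρ S) (by simp)
  choose K hKS hKc hK using key
  have hKm : ∀ n, MeasurableSet (K n) := fun n =>
    @IsClosed.measurableSet X _ t _ inferInstance (hKc n).2
  refine ⟨t, Set.accumulate K, fun i => htm i _ (hmo i),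
    @isCompact_accumulate X t K fun n => (hKc n).1,
    fun k => .biUnion (Set.to_countable _) fun n _ => hKm n, Set.monotone_accumulate,
    fun k => Set.iUnion₂_subset fun n _ => hKS n, ?_⟩
  rw [Set.iUnion_accumulate]
  refine hμρ ?_
  have hle : ρ S ≤ ρ (⋃ n, K n) := by
    refine ge_of_tendsto' (x := atTop) (f := fun n : ℕ => ρ (⋃ n, K n) + ((n : ℝ≥0∞) + 1)⁻¹)
      ?_ fun n => (hK n).le.trans ?_
    · have := (ENNReal.tendsto_inv_nat_nhds_zero.comp (tendsto_add_atTop_nat 1)).const_add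
        (ρ (⋃ n, K n))
      simpa [Function.comp_def] using this
    · gcongr
      exact Set.subset_iUnion K n
  have hdiff : ρ (S \ ⋃ n, K n) = 0 := by
    rw [measure_sdiff (Set.iUnion_subset hKS) (MeasurableSet.iUnion hKm).nullMeasurableSet
      (measure_ne_top _ _)]
    exact tsub_eq_zero_of_le hle
  refine measure_mono_null ?_ (measure_union_null (hρμ hSμ) hdiff)
  intro x hx
  by_cases hxS : x ∈ S
  · exact Or.inr ⟨hxS, hx⟩
  · exact Or.inl hxS

/-- If countably many measurable rectangles cover `X × Y` up to a marginally null set, then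
finitely many of them cover `P k ×ˢ Q k`, for each `k`, where the sequences `P` and `Q` exhaust `X`
and `Y` up to null sets. -/
theorem exists_exhaustion_finite_cover [StandardBorelSpace X] [StandardBorelSpace Y]
    (μ : Measure X) [SigmaFinite μ] (ν : Measure Y) [SigmaFinite ν]
    {ι : Type*} [Countable ι] (A : ι → Set X) (B : ι → Set Y)
    (hA : ∀ i, MeasurableSet (A i)) (hB : ∀ i, MeasurableSet (B i))
    (h : ∀ᶠ p in ae μ ×ˢ ae ν, ∃ i, p.1 ∈ A i ∧ p.2 ∈ B i) :
    ∃ (P : ℕ → Set X) (Q : ℕ → Set Y), (∀ k, MeasurableSet (P k)) ∧ (∀ k, MeasurableSet (Q k)) ∧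
      Monotone P ∧ Monotone Q ∧ μ (⋃ k, P k)ᶜ = 0 ∧ ν (⋃ k, Q k)ᶜ = 0 ∧
      ∀ k, ∃ t : Finset ι, ∀ p ∈ P k ×ˢ Q k, ∃ i ∈ t, p.1 ∈ A i ∧ p.2 ∈ B i := by
  obtain ⟨p, hp, q, hq, hpq⟩ := eventually_prod_iff.1 h
  have hS : MeasurableSet (toMeasurable μ {x | ¬ p x})ᶜ := (measurableSet_toMeasurable _ _).compl
  have hT : MeasurableSet (toMeasurable ν {y | ¬ q y})ᶜ := (measurableSet_toMeasurable _ _).compl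
  obtain ⟨tX, P, hAo, hPc, hPm, hPmono, hPS, hP⟩ := exists_topology_compact_exhaustion μ A hA hS
    (by rw [compl_compl, measure_toMeasurable]; exact hp)
  obtain ⟨tY, Q, hBo, hQc, hQm, hQmono, hQT, hQ⟩ := exists_topology_compact_exhaustion ν B hB hT
    (by rw [compl_compl, measure_toMeasurable]; exact hq)
  refine ⟨P, Q, hPm, hQm, hPmono, hQmono, hP, hQ, fun k => ?_⟩
  obtain ⟨t, ht⟩ := ((hPc k).prod (hQc k)).elim_finite_subcover (fun i => A i ×ˢ B i)
    (fun i => (hAo i).prod (hBo i)) (by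
      rintro ⟨x, y⟩ ⟨hx, hy⟩
      have hx' : p x := by
        by_contra hn
        exact hPS k hx (subset_toMeasurable _ _ hn)
      have hy' : q y := by
        by_contra hn
        exact hQT k hy (subset_toMeasurable _ _ hn)
      obtain ⟨i, hi⟩ := hpq hx' hy'
      exact Set.mem_iUnion.2 ⟨i, hi⟩)
  refine ⟨t, fun r hr => ?_⟩
  obtain ⟨i, hi, hri⟩ := Set.mem_iUnion₂.1 (ht hr)
  exact ⟨i, hi, hri⟩

/-! ### The norm of `Γ` -/


/-- Representations may be indexed by any denumerable type. -/
theorem gammaNorm_le_tsum {ι : Type*} [Denumerable ι] {F : X × Y → ℂ}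
    {f : ι → X → ℂ} {g : ι → Y → ℂ} (hf : ∀ i, MemLp (f i) 2 μ) (hg : ∀ i, MemLp (g i) 2 ν)
    (h : ∀ᶠ p in ae μ ×ˢ ae ν, HasSum (fun i => f i p.1 * g i p.2) (F p)) :
    gammaNorm μ ν F ≤ ∑' i, eLpNorm (f i) 2 μ * eLpNorm (g i) 2 ν := by
  let e : ℕ ≃ ι := (Denumerable.eqv ι).symm
  have hrep : IsL2Rep μ ν F (fun n => f (e n)) (fun n => g (e n)) := by
    refine ⟨fun n => hf _, fun n => hg _, marginallyAE_iff.2 ?_⟩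
    filter_upwards [h] with p hp
    exact (Equiv.hasSum_iff e (f := fun i => f i p.1 * g i p.2)).2 hp
  refine (iInf₂_le_of_le _ _ (iInf_le _ hrep)).trans_eq ?_
  exact e.tsum_eq fun i => eLpNorm (f i) 2 μ * eLpNorm (g i) 2 ν

theorem exists_isL2Rep_lt {F : X × Y → ℂ} {r : ℝ≥0∞} (h : gammaNorm μ ν F < r) :
    ∃ (f : ℕ → X → ℂ) (g : ℕ → Y → ℂ), IsL2Rep μ ν F f g ∧
      ∑' n, eLpNorm (f n) 2 μ * eLpNorm (g n) 2 ν < r := by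
  simpa only [gammaNorm, iInf_lt_iff, exists_prop] using h

theorem IsL2Rep.eventually {F : X × Y → ℂ} {f : ℕ → X → ℂ} {g : ℕ → Y → ℂ}
    (h : IsL2Rep μ ν F f g) :
    ∀ᶠ p in ae μ ×ˢ ae ν, HasSum (fun n => f n p.1 * g n p.2) (F p) :=
  marginallyAE_iff.1 h.hasSum

/-- A bound on all representations of `F` gives a bound by the norm of `F`. Finiteness of the norm
matters only for `C = 0`, where `C * ∞ = 0`. -/
theorem gammaNorm_le_mul {F G : X × Y → ℂ} {C : ℝ≥0}
    (h : ∀ f g, IsL2Rep μ ν F f g →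
      gammaNorm μ ν G ≤ C * ∑' n, eLpNorm (f n) 2 μ * eLpNorm (g n) 2 ν)
    (hF : F ∈ Gamma μ ν) : gammaNorm μ ν G ≤ C * gammaNorm μ ν F := by
  refine ENNReal.le_mul_of_forall_lt (Or.inr hF.ne) (Or.inl ENNReal.coe_ne_top)
    fun a ha b hb => ?_
  obtain ⟨f, g, hfg, hlt⟩ := exists_isL2Rep_lt hb
  exact (h f g hfg).trans (mul_le_mul' ha.le hlt.le)

theorem gammaNorm_add_le (F G : X × Y → ℂ) :
    gammaNorm μ ν (F + G) ≤ gammaNorm μ ν F + gammaNorm μ ν G := by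
  refine ENNReal.le_of_forall_pos_le_add fun ε hε hlt => ?_
  have hε' : ((ε / 2 : ℝ≥0) : ℝ≥0∞) ≠ 0 := by
    rw [ENNReal.coe_ne_zero]
    exact (half_pos hε).ne'
  obtain ⟨f, g, hfg, h⟩ := exists_isL2Rep_lt
    (ENNReal.lt_add_right (ENNReal.add_lt_top.1 hlt).1.ne hε')
  obtain ⟨f', g', hfg', h'⟩ := exists_isL2Rep_lt
    (ENNReal.lt_add_right (ENNReal.add_lt_top.1 hlt).2.ne hε')
  have key : gammaNorm μ ν (F + G) ≤ ∑' i : ℕ ⊕ ℕ, eLpNorm (Sum.elim f f' i) 2 μ *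
      eLpNorm (Sum.elim g g' i) 2 ν := by
    refine gammaNorm_le_tsum (Sum.forall.2 ⟨hfg.memLp_left, hfg'.memLp_left⟩)
      (Sum.forall.2 ⟨hfg.memLp_right, hfg'.memLp_right⟩) ?_
    filter_upwards [hfg.eventually, hfg'.eventually] with p h₁ h₂
    exact HasSum.sum h₁ h₂
  rw [ENNReal.summable.tsum_sum ENNReal.summable] at key
  refine key.trans ((add_le_add h.le h'.le).trans_eq ?_)
  have : (ε : ℝ≥0∞) = (ε / 2 : ℝ≥0) + (ε / 2 : ℝ≥0) := by
    rw [← ENNReal.coe_add, add_halves]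
  rw [this]
  abel

theorem gammaNorm_zero : gammaNorm μ ν 0 = 0 := by
  have := gammaNorm_le_tsum (μ := μ) (ν := ν) (F := 0) (f := fun _ : ℕ => 0) (g := fun _ => 0)
    (fun _ => MemLp.zero) (fun _ => MemLp.zero) (.of_forall fun p => by simp)
  simpa using this

theorem sq_eLpNorm_two (f : X → ℂ) : eLpNorm f 2 μ ^ 2 = ∫⁻ x, ‖f x‖ₑ ^ 2 ∂μ := by
  have := eLpNorm_nnreal_pow_eq_lintegral (μ := μ) (f := f) (p := 2) two_ne_zero
  simpa only [NNReal.coe_ofNat, ENNReal.coe_ofNat, ENNReal.rpow_ofNat] using this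

/-- After the term `u i` is rescaled by the square root of `t i / ‖u i‖₂`, the integral of the sum
of the squares is at most `∑ i, ‖u i‖₂ * t i`. If `‖u i‖₂ = 0`, the scaling factor may be `∞`, but it
multiplies a function that is zero almost everywhere. -/
theorem ae_tsum_div_mul_sq_ne_top {ι : Type*} [Countable ι] {u : ι → X → ℂ} {t : ι → ℝ≥0∞}
    (hu : ∀ i, MemLp (u i) 2 μ) (hut : ∑' i, eLpNorm (u i) 2 μ * t i ≠ ∞) :
    ∀ᵐ x ∂μ, ∑' i, t i / eLpNorm (u i) 2 μ * ‖u i x‖ₑ ^ 2 ≠ ∞ := by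
  have hm : ∀ i, AEMeasurable (fun x => t i / eLpNorm (u i) 2 μ * ‖u i x‖ₑ ^ 2) μ := fun i =>
    ((hu i).aestronglyMeasurable.enorm.pow_const 2).const_mul _
  refine (ae_lt_top' (AEMeasurable.tsum hm) ?_).mono fun z hz => hz.ne
  rw [lintegral_tsum hm]
  refine ne_top_of_le_ne_top hut (ENNReal.tsum_le_tsum fun i => ?_)
  rw [lintegral_const_mul'' _ ((hu i).aestronglyMeasurable.enorm.pow_const 2),
    ← sq_eLpNorm_two, sq, ← mul_assoc, mul_comm (eLpNorm _ _ _)]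
  gcongr
  rw [mul_comm]
  exact ENNReal.mul_div_le

theorem ae_eq_zero_of_eLpNorm_two_eq_zero {ι : Type*} [Countable ι] {u : ι → X → ℂ}
    (hu : ∀ i, MemLp (u i) 2 μ) : ∀ᵐ x ∂μ, ∀ i, eLpNorm (u i) 2 μ = 0 → u i x = 0 := by
  refine ae_all_iff.2 fun i => ?_
  by_cases h0 : eLpNorm (u i) 2 μ = 0
  · filter_upwards [(eLpNorm_eq_zero_iff (hu i).aestronglyMeasurable two_ne_zero).1 h0]
      with x hx _ using hx
  · exact .of_forall fun x hx => absurd hx h0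

theorem mul_le_div_mul_sq {a b s t : ℝ≥0∞} (ht : t ≠ 0) (htT : t ≠ ∞) (h : a * t ≤ b * s) :
    a * b ≤ s / t * b ^ 2 := by
  calc a * b ≤ b * s / t * b := by
        gcongr
        exact (ENNReal.le_div_iff_mul_le (Or.inl ht) (Or.inl htT)).2 h
    _ = s / t * b ^ 2 := by
        rw [mul_div_assoc]
        ring

/-- The series in a representation of finite norm converges absolutely m.a.e. The factors of each
term are rescaled to have equal `L₂` norms; then the squares of the left factors, and of the right
factors, have finite sums almost everywhere. -/
theorem eventually_tsum_ne_top {ι : Type*} [Countable ι] {f : ι → X → ℂ} {g : ι → Y → ℂ}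
    (hf : ∀ i, MemLp (f i) 2 μ) (hg : ∀ i, MemLp (g i) 2 ν)
    (h : ∑' i, eLpNorm (f i) 2 μ * eLpNorm (g i) 2 ν ≠ ∞) :
    ∀ᶠ p in ae μ ×ˢ ae ν, ∑' i, ‖f i p.1‖ₑ * ‖g i p.2‖ₑ ≠ ∞ := by
  have hleft := ae_tsum_div_mul_sq_ne_top hf h
  have hright := ae_tsum_div_mul_sq_ne_top hg (t := fun i => eLpNorm (f i) 2 μ)
    (by simpa only [mul_comm] using h)
  have hf0 := ae_eq_zero_of_eLpNorm_two_eq_zero hf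
  have hg0 := ae_eq_zero_of_eLpNorm_two_eq_zero hg
  filter_upwards [(hleft.and hf0).prod_mk (hright.and hg0)] with p hp
  obtain ⟨⟨h₁, h₂⟩, h₃, h₄⟩ := hp
  refine ne_top_of_le_ne_top (ENNReal.add_ne_top.2 ⟨h₁, h₃⟩) ?_
  rw [← ENNReal.tsum_add]
  refine ENNReal.tsum_le_tsum fun i => ?_
  set s := eLpNorm (f i) 2 μ with hs
  set t := eLpNorm (g i) 2 ν with ht
  by_cases hs0 : s = 0
  · simp [h₂ i hs0]
  by_cases ht0 : t = 0
  · simp [h₄ i ht0]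
  have hsT : s ≠ ∞ := (hf i).eLpNorm_ne_top
  have htT : t ≠ ∞ := (hg i).eLpNorm_ne_top
  rcases le_total (‖f i p.1‖ₑ * t) (‖g i p.2‖ₑ * s) with hle | hle
  · exact le_add_left (mul_le_div_mul_sq ht0 htT hle)
  · rw [mul_comm]
    exact le_add_right (mul_le_div_mul_sq hs0 hsT hle)

/-- Vanishing on a set is a closed condition for the norm of `Γ`: a sequence that converges fast
enough in norm converges m.a.e. -/
theorem VanishesOn.of_approx {F : X × Y → ℂ} {K : Set (X × Y)}
    (h : ∀ ε : ℝ≥0∞, 0 < ε → ∃ G, VanishesOn μ ν G K ∧ gammaNorm μ ν (F - G) < ε) :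
    VanishesOn μ ν F K := by
  obtain ⟨δ, hδ, hδsum⟩ := ENNReal.exists_pos_sum_of_countable' one_ne_zero ℕ
  choose G hG hGδ using fun n => h (δ n) (hδ n)
  choose f g hfg hlt using fun n => exists_isL2Rep_lt (hGδ n)
  have hfin := eventually_tsum_ne_top (μ := μ) (ν := ν) (ι := ℕ × ℕ) (f := fun i => f i.1 i.2)
    (g := fun i => g i.1 i.2) (fun i => (hfg _).memLp_left _) (fun i => (hfg _).memLp_right _) (by
      rw [ENNReal.tsum_prod (f := fun n k => eLpNorm (f n k) 2 μ * eLpNorm (g n k) 2 ν)]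
      exact ((ENNReal.tsum_le_tsum fun n => (hlt n).le).trans_lt
        (hδsum.trans ENNReal.one_lt_top)).ne)
  rw [vanishesOn_iff]
  filter_upwards [hfin, eventually_countable_forall.2 fun n => (hfg n).eventually,
    eventually_countable_forall.2 fun n => vanishesOn_iff.1 (hG n)] with p h₁ h₂ h₃ hpK
  rw [ENNReal.tsum_prod (f := fun n k => ‖f n k p.1‖ₑ * ‖g n k p.2‖ₑ)] at h₁
  have hlim := ENNReal.tendsto_atTop_zero_of_tsum_ne_top h₁
  have hle : ∀ n, ‖F p‖ₑ ≤ ∑' k, ‖f n k p.1‖ₑ * ‖g n k p.2‖ₑ := fun n => by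
    have hFp : F p = ∑' k, f n k p.1 * g n k p.2 := by
      rw [(h₂ n).tsum_eq, Pi.sub_apply, h₃ n hpK, sub_zero]
    rw [hFp]
    simpa only [enorm_mul] using enorm_tsum_le_tsum_enorm (f := fun k => f n k p.1 * g n k p.2)
  simpa using ge_of_tendsto' hlim hle

/-! ### Multipliers of `Γ` -/


/-- Functions `m` such that `F ↦ m F` is a bounded operator on `Γ`. -/
def IsMultiplier (μ : Measure X) (ν : Measure Y) (m : X × Y → ℂ) : Prop :=
  ∃ C : ℝ≥0, ∀ F ∈ Gamma μ ν, gammaNorm μ ν (m * F) ≤ C * gammaNorm μ ν F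

theorem add_mem_Gamma {F G : X × Y → ℂ} (hF : F ∈ Gamma μ ν) (hG : G ∈ Gamma μ ν) :
    F + G ∈ Gamma μ ν :=
  (gammaNorm_add_le F G).trans_lt (ENNReal.add_lt_top.2 ⟨hF, hG⟩)

theorem IsMultiplier.mul_mem_Gamma {m F : X × Y → ℂ} (hm : IsMultiplier μ ν m)
    (hF : F ∈ Gamma μ ν) : m * F ∈ Gamma μ ν := by
  obtain ⟨C, hC⟩ := hm
  exact (hC F hF).trans_lt (ENNReal.mul_lt_top ENNReal.coe_lt_top hF)

theorem IsMultiplier.mul {m n : X × Y → ℂ} (hm : IsMultiplier μ ν m) (hn : IsMultiplier μ ν n) :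
    IsMultiplier μ ν (m * n) := by
  obtain ⟨C, hC⟩ := hm
  obtain ⟨D, hD⟩ := id hn
  refine ⟨C * D, fun F hF => ?_⟩
  rw [mul_assoc, ENNReal.coe_mul, mul_assoc]
  exact (hC _ (hn.mul_mem_Gamma hF)).trans (by gcongr; exact hD F hF)

theorem IsMultiplier.add {m n : X × Y → ℂ} (hm : IsMultiplier μ ν m) (hn : IsMultiplier μ ν n) :
    IsMultiplier μ ν (m + n) := by
  obtain ⟨C, hC⟩ := hm
  obtain ⟨D, hD⟩ := hn
  refine ⟨C + D, fun F hF => ?_⟩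
  rw [add_mul, ENNReal.coe_add, add_mul]
  exact (gammaNorm_add_le _ _).trans (add_le_add (hC F hF) (hD F hF))

theorem isMultiplier_one : IsMultiplier μ ν 1 :=
  ⟨1, fun F _ => by simp⟩

theorem gammaNorm_neg_le {F : X × Y → ℂ} (hF : F ∈ Gamma μ ν) :
    gammaNorm μ ν (-F) ≤ gammaNorm μ ν F := by
  have : gammaNorm μ ν (-F) ≤ (1 : ℝ≥0) * gammaNorm μ ν F := by
    refine gammaNorm_le_mul (fun f g hfg => ?_) hF
    have := gammaNorm_le_tsum (μ := μ) (ν := ν) (F := -F) (f := fun n => -f n) (g := g)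
      (fun n => (hfg.memLp_left n).neg) hfg.memLp_right (by
        filter_upwards [hfg.eventually] with p hp
        simpa using hp.neg)
    simpa [eLpNorm_neg] using this
  simpa using this

theorem neg_mem_Gamma {F : X × Y → ℂ} (hF : F ∈ Gamma μ ν) : -F ∈ Gamma μ ν :=
  (gammaNorm_neg_le hF).trans_lt hF

theorem isMultiplier_neg_one : IsMultiplier μ ν (-1) :=
  ⟨1, fun F hF => by simpa using gammaNorm_neg_le hF⟩

/-- Cutting down to a measurable rectangle can be done in each term of a representation. -/
theorem gammaNorm_indicator_prod_mul_le {F : X × Y → ℂ} {f : ℕ → X → ℂ} {g : ℕ → Y → ℂ}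
    (hfg : IsL2Rep μ ν F f g) {A : Set X} {B : Set Y} (hA : MeasurableSet A)
    (hB : MeasurableSet B) :
    gammaNorm μ ν ((A ×ˢ B).indicator 1 * F) ≤
      ∑' n, eLpNorm (A.indicator (f n)) 2 μ * eLpNorm (B.indicator (g n)) 2 ν := by
  refine gammaNorm_le_tsum (fun n => (hfg.memLp_left n).indicator hA)
    (fun n => (hfg.memLp_right n).indicator hB) ?_
  filter_upwards [hfg.eventually] with p hp
  by_cases h₁ : p.1 ∈ A <;> by_cases h₂ : p.2 ∈ B <;> simp [h₁, h₂, Set.indicator, hp]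

theorem gammaNorm_indicator_prod_mul_le_self {F : X × Y → ℂ} (hF : F ∈ Gamma μ ν) {A : Set X}
    {B : Set Y} (hA : MeasurableSet A) (hB : MeasurableSet B) :
    gammaNorm μ ν ((A ×ˢ B).indicator 1 * F) ≤ gammaNorm μ ν F := by
  have : gammaNorm μ ν ((A ×ˢ B).indicator 1 * F) ≤ (1 : ℝ≥0) * gammaNorm μ ν F := by
    refine gammaNorm_le_mul (fun f g hfg => ?_) hF
    rw [ENNReal.coe_one, one_mul]
    refine (gammaNorm_indicator_prod_mul_le hfg hA hB).trans (ENNReal.tsum_le_tsum fun n => ?_)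
    gcongr <;> exact eLpNorm_indicator_le _
  simpa using this

theorem isMultiplier_indicator_prod {A : Set X} {B : Set Y} (hA : MeasurableSet A)
    (hB : MeasurableSet B) : IsMultiplier μ ν ((A ×ˢ B).indicator 1) :=
  ⟨1, fun F hF => by simpa using gammaNorm_indicator_prod_mul_le_self hF hA hB⟩

theorem exists_tsum_enorm_sq_le {φ : ℕ → X → ℂ}
    (h : ∃ a : X → ℝ, MemLp a ∞ μ ∧ ∀ᵐ x ∂μ, HasSum (fun i => ‖φ i x‖ ^ 2) (a x)) :
    ∃ A : ℝ≥0, ∀ᵐ x ∂μ, ∑' i, ‖φ i x‖ₑ ^ 2 ≤ (A : ℝ≥0∞) ^ 2 := by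
  obtain ⟨a, ha, hsum⟩ := h
  lift eLpNorm a ∞ μ to ℝ≥0 using ha.eLpNorm_ne_top with M hM
  have hbound : ∀ᵐ x ∂μ, ‖a x‖ₑ ≤ M := by
    rw [hM, eLpNorm_exponent_top]
    exact ae_le_eLpNormEssSup
  -- the bound is on squares, and `M ≤ (M + 1) ^ 2`
  refine ⟨M + 1, ?_⟩
  filter_upwards [hbound, hsum] with x h₁ h₂
  have h₃ : ∑' i, ‖φ i x‖ₑ ^ 2 = ENNReal.ofReal (a x) := by
    rw [← h₂.tsum_eq, ENNReal.ofReal_tsum_of_nonneg (fun i => by positivity) h₂.summable]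
    refine tsum_congr fun i => ?_
    rw [ENNReal.ofReal_pow (norm_nonneg _), ofReal_norm]
  rw [h₃]
  calc ENNReal.ofReal (a x) ≤ ‖a x‖ₑ := Real.ofReal_le_enorm _
    _ ≤ M := h₁
    _ ≤ ((M + 1 : ℝ≥0) : ℝ≥0∞) ^ 2 := by
      norm_cast
      nlinarith [M.2, sq_nonneg M, zero_le (a := M)]

theorem tsum_sq_eLpNorm_mul_le {φ : ℕ → X → ℂ} {f : X → ℂ} {A : ℝ≥0∞}
    (hφ : ∀ i, MemLp (φ i) ∞ μ) (hf : MemLp f 2 μ) (hA : ∀ᵐ x ∂μ, ∑' i, ‖φ i x‖ₑ ^ 2 ≤ A ^ 2) :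
    ∑' i, eLpNorm (φ i * f) 2 μ ^ 2 ≤ (A * eLpNorm f 2 μ) ^ 2 := by
  have hm : AEMeasurable (fun x => ‖f x‖ₑ ^ 2) μ := hf.aestronglyMeasurable.enorm.pow_const 2
  simp_rw [mul_pow, sq_eLpNorm_two, Pi.mul_apply, enorm_mul, mul_pow]
  have hm' : ∀ i, AEMeasurable (fun x => ‖φ i x‖ₑ ^ 2 * ‖f x‖ₑ ^ 2) μ := fun i =>
    ((hφ i).aestronglyMeasurable.enorm.pow_const 2).mul hm
  rw [← lintegral_tsum hm', ← lintegral_const_mul'' _ hm]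
  refine lintegral_mono_ae ?_
  filter_upwards [hA] with x hx
  rw [ENNReal.tsum_mul_right]
  gcongr

/-- The Cauchy–Schwarz inequality for series in `ℝ≥0∞`. -/
theorem tsum_mul_le_of_tsum_sq_le {u v : ℕ → ℝ≥0∞} {α β : ℝ≥0∞} (hu : ∑' i, u i ^ 2 ≤ α ^ 2)
    (hv : ∑' i, v i ^ 2 ≤ β ^ 2) : ∑' i, u i * v i ≤ α * β := by
  have key := ENNReal.lintegral_mul_le_Lp_mul_Lq (Measure.count : Measure ℕ)
    Real.HolderConjugate.two_two (f := u) (g := v) (by fun_prop) (by fun_prop)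
  simp only [lintegral_count, Pi.mul_apply, ENNReal.rpow_ofNat] at key
  have hroot : ∀ {a b : ℝ≥0∞}, a ≤ b ^ 2 → a ^ (1 / 2 : ℝ) ≤ b := fun {a b} h => by
    rw [← ENNReal.rpow_ofNat] at h
    simpa using ENNReal.rpow_le_rpow_iff (z := 2) (by norm_num) |>.1
      (by rw [← ENNReal.rpow_mul]; simpa using h)
  exact key.trans (mul_le_mul' (hroot hu) (hroot hv))

theorem hasSum_mul_prod {u v : ℕ → ℂ} {a b : ℂ} (hu : HasSum u a) (hv : HasSum v b) :
    HasSum (fun i : ℕ × ℕ => u i.1 * v i.2) (a * b) :=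
  hu.mul hv (summable_mul_of_summable_norm hu.summable.norm hv.summable.norm)

/-- Elements of `V^∞` are multipliers: multiply the two series term by term and apply the
Cauchy–Schwarz inequality to the sum over the terms of the multiplier. -/
theorem IsMultiplier.of_mem_VInfty {w : X × Y → ℂ} (hw : w ∈ VInfty μ ν) : IsMultiplier μ ν w := by
  obtain ⟨φ, ψ, hφ, hψ, ha, hb, hsum⟩ := hw
  obtain ⟨A, hA⟩ := exists_tsum_enorm_sq_le ha
  obtain ⟨B, hB⟩ := exists_tsum_enorm_sq_le hb
  refine ⟨A * B, fun F hF => gammaNorm_le_mul (fun f g hfg => ?_) hF⟩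
  have hf : ∀ i : ℕ × ℕ, MemLp (φ i.2 * f i.1) 2 μ := fun i => (hfg.memLp_left i.1).mul (hφ i.2)
  have hg : ∀ i : ℕ × ℕ, MemLp (ψ i.2 * g i.1) 2 ν := fun i => (hfg.memLp_right i.1).mul (hψ i.2)
  have hprod : ∀ᶠ p in ae μ ×ˢ ae ν, HasSum
      (fun i : ℕ × ℕ => (φ i.2 * f i.1) p.1 * (ψ i.2 * g i.1) p.2) ((w * F) p) := by
    filter_upwards [hfg.eventually, marginallyAE_iff.1 hsum] with p h₁ h₂
    rw [Pi.mul_apply, mul_comm]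
    have h₃ := hasSum_mul_prod h₁ h₂
    have hterm : (fun i : ℕ × ℕ => (φ i.2 * f i.1) p.1 * (ψ i.2 * g i.1) p.2) =
        fun i => f i.1 p.1 * g i.1 p.2 * (φ i.2 p.1 * ψ i.2 p.2) := by
      ext i
      simp only [Pi.mul_apply]
      ring
    rw [hterm]
    exact h₃
  have key := gammaNorm_le_tsum hf hg hprod
  refine key.trans ?_
  rw [ENNReal.tsum_prod (f := fun n i => eLpNorm (φ i * f n) 2 μ * eLpNorm (ψ i * g n) 2 ν),
    ← ENNReal.tsum_mul_left]
  refine ENNReal.tsum_le_tsum fun n => ?_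
  refine (tsum_mul_le_of_tsum_sq_le (tsum_sq_eLpNorm_mul_le hφ (hfg.memLp_left n) hA)
    (tsum_sq_eLpNorm_mul_le hψ (hfg.memLp_right n) hB)).trans_eq ?_
  rw [ENNReal.coe_mul]
  ring

/-! ### Elementary sets -/

/-- Sets that are both pseudo-open and pseudo-closed and whose indicator is a multiplier. They form
an algebra that contains the measurable rectangles. -/
structure IsElementary (μ : Measure X) (ν : Measure Y) (W : Set (X × Y)) : Prop where
  pseudoOpen : PseudoOpen μ ν W
  pseudoOpen_compl : PseudoOpen μ ν Wᶜ
  isMultiplier : IsMultiplier μ ν (W.indicator 1)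

theorem IsElementary.prod {A : Set X} {B : Set Y} (hA : MeasurableSet A) (hB : MeasurableSet B) :
    IsElementary μ ν (A ×ˢ B) :=
  ⟨.prod hA hB, .compl_prod hA hB, isMultiplier_indicator_prod hA hB⟩

theorem IsElementary.inter {V W : Set (X × Y)} (hV : IsElementary μ ν V)
    (hW : IsElementary μ ν W) : IsElementary μ ν (V ∩ W) := by
  refine ⟨hV.1.inter hW.1, Set.compl_inter V W ▸ hV.2.union hW.2, ?_⟩
  rw [Set.inter_indicator_one]
  exact hV.3.mul hW.3

theorem IsElementary.compl {W : Set (X × Y)} (hW : IsElementary μ ν W) :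
    IsElementary μ ν Wᶜ := by
  refine ⟨hW.2, by rw [compl_compl]; exact hW.1, ?_⟩
  rw [Set.indicator_compl, sub_eq_add_neg, ← neg_one_mul]
  exact isMultiplier_one.add (isMultiplier_neg_one.mul hW.3)

theorem IsElementary.biUnion {ι : Type*} (t : Finset ι) {W : ι → Set (X × Y)}
    (hW : ∀ i, IsElementary μ ν (W i)) : IsElementary μ ν (⋃ i ∈ t, W i) := by
  classical
  induction t using Finset.induction_on with
  | empty => simpa using IsElementary.prod (μ := μ) (ν := ν) (A := ∅) (B := ∅) .empty .empty
  | insert i t _ ih =>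
    rw [Finset.set_biUnion_insert, ← compl_compl (_ ∪ _), Set.compl_union]
    exact ((hW i).compl.inter ih.compl).compl

/-! ### Approximation by restriction to rectangles -/

/-- The finite measure with density `|f|²` is continuous along the complements of the exhausting
sets. -/
theorem tendsto_eLpNorm_indicator_compl {P : ℕ → Set X} (hP : ∀ k, MeasurableSet (P k))
    (hmono : Monotone P) (hnull : μ (⋃ k, P k)ᶜ = 0) {f : X → ℂ} (hf : MemLp f 2 μ) :
    Tendsto (fun k => eLpNorm ((P k)ᶜ.indicator f) 2 μ) atTop (𝓝 0) := by
  set ρ := μ.withDensity fun x => ‖f x‖ₑ ^ 2 with hρdef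
  have hρ : ρ Set.univ ≠ ∞ := by
    rw [withDensity_apply _ .univ, setLIntegral_univ, ← sq_eLpNorm_two]
    exact ENNReal.pow_ne_top hf.eLpNorm_ne_top
  have hsq : ∀ k, eLpNorm ((P k)ᶜ.indicator f) 2 μ = ρ (P k)ᶜ ^ (1 / 2 : ℝ) := fun k => by
    have : eLpNorm ((P k)ᶜ.indicator f) 2 μ ^ 2 = ρ (P k)ᶜ := by
      rw [sq_eLpNorm_two, withDensity_apply _ (hP k).compl,
        ← lintegral_indicator (hP k).compl]
      congr 1
      ext x
      by_cases hx : x ∈ (P k)ᶜ <;> simp [Set.indicator, hx]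
    rw [← this, ← ENNReal.rpow_natCast, ← ENNReal.rpow_mul]
    simp
  have hlim := tendsto_measure_iInter_atTop (μ := ρ) (s := fun k => (P k)ᶜ)
    (fun k => (hP k).compl.nullMeasurableSet) (fun i j hij => Set.compl_subset_compl.2 (hmono hij))
    ⟨0, ne_top_of_le_ne_top hρ (measure_mono (Set.subset_univ _))⟩
  rw [← Set.compl_iUnion, withDensity_absolutelyContinuous μ _ hnull] at hlim
  simp_rw [hsq]
  simpa [Function.comp_def] using
    ((ENNReal.continuous_rpow_const (y := 1 / 2)).tendsto 0).comp hlim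

theorem tendsto_tsum_mul_zero {u : ℕ → ℕ → ℝ≥0∞} {a b : ℕ → ℝ≥0∞} (hua : ∀ k n, u k n ≤ a n)
    (hab : ∑' n, a n * b n ≠ ∞) (hb : ∀ n, b n ≠ ∞)
    (hu : ∀ n, Tendsto (fun k => u k n) atTop (𝓝 0)) :
    Tendsto (fun k => ∑' n, u k n * b n) atTop (𝓝 0) := by
  have := tendsto_lintegral_of_dominated_convergence (μ := (Measure.count : Measure ℕ))
    (F := fun k n => u k n * b n) (f := fun _ => 0) (fun n => a n * b n)
    (fun k => measurable_from_top)
    (fun k => .of_forall fun n => mul_le_mul_left (hua k n) _)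
    (by rwa [lintegral_count])
    (.of_forall fun n => by
      simpa using ENNReal.Tendsto.mul_const (hu n) (Or.inr (hb n)))
  simpa only [lintegral_count, tsum_zero] using this

theorem tendsto_gammaNorm_indicator_compl_mul {P : ℕ → Set X} {Q : ℕ → Set Y}
    (hP : ∀ k, MeasurableSet (P k)) (hQ : ∀ k, MeasurableSet (Q k)) (hPmono : Monotone P)
    (hQmono : Monotone Q) (hPnull : μ (⋃ k, P k)ᶜ = 0) (hQnull : ν (⋃ k, Q k)ᶜ = 0)
    {F : X × Y → ℂ} (hF : F ∈ Gamma μ ν) :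
    Tendsto (fun k => gammaNorm μ ν ((P k ×ˢ Q k)ᶜ.indicator 1 * F)) atTop (𝓝 0) := by
  obtain ⟨f, g, hfg, hlt⟩ := exists_isL2Rep_lt hF
  have hle : ∀ k, gammaNorm μ ν ((P k ×ˢ Q k)ᶜ.indicator 1 * F) ≤
      ∑' n, eLpNorm ((P k)ᶜ.indicator (f n)) 2 μ * eLpNorm (g n) 2 ν +
      ∑' n, eLpNorm ((Q k)ᶜ.indicator (g n)) 2 ν * eLpNorm (f n) 2 μ := fun k => by
    -- the complement is the disjoint union of two rectangles, one small in `X`, one small in `Y`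
    have hsplit : (P k ×ˢ Q k)ᶜ.indicator 1 * F = ((P k)ᶜ ×ˢ Set.univ).indicator 1 * F +
        (P k ×ˢ (Q k)ᶜ).indicator 1 * F := by
      ext p
      by_cases h₁ : p.1 ∈ P k <;> by_cases h₂ : p.2 ∈ Q k <;> simp [h₁, h₂, Set.indicator]
    rw [hsplit]
    refine (gammaNorm_add_le _ _).trans (add_le_add ?_ ?_)
    · simpa using gammaNorm_indicator_prod_mul_le hfg (hP k).compl .univ
    · refine (gammaNorm_indicator_prod_mul_le hfg (hP k) (hQ k).compl).trans
        (ENNReal.tsum_le_tsum fun n => ?_)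
      rw [mul_comm]
      gcongr
      exact eLpNorm_indicator_le _
  refine tendsto_of_tendsto_of_tendsto_of_le_of_le tendsto_const_nhds ?_ (fun _ => zero_le) hle
  rw [← add_zero (0 : ℝ≥0∞)]
  refine Tendsto.add ?_ ?_
  · exact tendsto_tsum_mul_zero (fun k n => eLpNorm_indicator_le _) hlt.ne
      (fun n => (hfg.memLp_right n).eLpNorm_ne_top)
      fun n => tendsto_eLpNorm_indicator_compl hP hPmono hPnull (hfg.memLp_left n)
  · exact tendsto_tsum_mul_zero (fun k n => eLpNorm_indicator_le _)
      (by simpa only [mul_comm] using hlt.ne) (fun n => (hfg.memLp_left n).eLpNorm_ne_top)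
      fun n => tendsto_eLpNorm_indicator_compl hQ hQmono hQnull (hfg.memLp_right n)

/-! ### The closed ideals `Φ₀(K)` -/


theorem gammaNorm_sub_le (F G H : X × Y → ℂ) :
    gammaNorm μ ν (F - H) ≤ gammaNorm μ ν (F - G) + gammaNorm μ ν (G - H) := by
  rw [← sub_add_sub_cancel F G H]
  exact gammaNorm_add_le _ _

theorem sub_mem_Gamma {F G : X × Y → ℂ} (hF : F ∈ Gamma μ ν) (hG : G ∈ Gamma μ ν) :
    F - G ∈ Gamma μ ν :=
  sub_eq_add_neg F G ▸ add_mem_Gamma hF (neg_mem_Gamma hG)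

theorem gammaNorm_sub_comm_le {F G : X × Y → ℂ} (h : F - G ∈ Gamma μ ν) :
    gammaNorm μ ν (G - F) ≤ gammaNorm μ ν (F - G) := by
  rw [← neg_sub]
  exact gammaNorm_neg_le h

theorem mem_PhiZero_of_vanishesNear {F : X × Y → ℂ} {K : Set (X × Y)} (hF : F ∈ Gamma μ ν)
    (h : VanishesNear μ ν F K) : F ∈ PhiZero μ ν K :=
  ⟨hF, fun ε hε => ⟨F, ⟨hF, h⟩, by rwa [sub_self, gammaNorm_zero]⟩⟩

theorem PhiZero_subset_Phi (K : Set (X × Y)) : PhiZero μ ν K ⊆ Phi μ ν K := by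
  rintro F ⟨hF, h⟩
  refine ⟨hF, VanishesOn.of_approx fun ε hε => ?_⟩
  obtain ⟨G, ⟨_, hGK⟩, hlt⟩ := h ε hε
  exact ⟨G, hGK.vanishesOn, hlt⟩

theorem PhiZero_anti {K L : Set (X × Y)} (hKL : K ⊆ L) : PhiZero μ ν L ⊆ PhiZero μ ν K := by
  rintro F ⟨hF, h⟩
  refine ⟨hF, fun ε hε => ?_⟩
  obtain ⟨G, ⟨hG, hGL⟩, hlt⟩ := h ε hε
  exact ⟨G, ⟨hG, hGL.mono hKL⟩, hlt⟩

theorem Phi_union (K L : Set (X × Y)) : Phi μ ν (K ∪ L) = Phi μ ν K ∩ Phi μ ν L := by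
  ext F
  simp only [Phi, Set.mem_inter_iff, Set.mem_ofPred_eq, vanishesOn_iff, Set.mem_union, or_imp,
    eventually_and]
  tauto

theorem mem_PhiZero_of_approx {F : X × Y → ℂ} {K : Set (X × Y)} (hF : F ∈ Gamma μ ν)
    (h : ∀ ε : ℝ≥0∞, 0 < ε → ∃ G ∈ PhiZero μ ν K, gammaNorm μ ν (F - G) < ε) :
    F ∈ PhiZero μ ν K := by
  refine ⟨hF, fun ε hε => ?_⟩
  obtain ⟨G, hG, hFG⟩ := h (ε / 2) (ENNReal.half_pos hε.ne')
  obtain ⟨H, hH, hGH⟩ := hG.2 (ε / 2) (ENNReal.half_pos hε.ne')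
  refine ⟨H, hH, (gammaNorm_sub_le F G H).trans_lt ?_⟩
  rw [← ENNReal.add_halves ε]
  exact ENNReal.add_lt_add hFG hGH

theorem add_mem_PhiZero {F G : X × Y → ℂ} {K : Set (X × Y)} (hF : F ∈ PhiZero μ ν K)
    (hG : G ∈ PhiZero μ ν K) : F + G ∈ PhiZero μ ν K := by
  refine ⟨add_mem_Gamma hF.1 hG.1, fun ε hε => ?_⟩
  obtain ⟨F', hF', hlt⟩ := hF.2 (ε / 2) (ENNReal.half_pos hε.ne')
  obtain ⟨G', hG', hlt'⟩ := hG.2 (ε / 2) (ENNReal.half_pos hε.ne')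
  refine ⟨F' + G', ⟨add_mem_Gamma hF'.1 hG'.1, hF'.2.add hG'.2⟩, ?_⟩
  rw [add_sub_add_comm, ← ENNReal.add_halves ε]
  exact (gammaNorm_add_le _ _).trans_lt (ENNReal.add_lt_add hlt hlt')

/-- If `G` vanishes near `K` and approximates `F`, then `m * G` vanishes near `K ∪ L` and
approximates `m * F`. -/
theorem mul_mem_PhiZero_union {m F : X × Y → ℂ} {K L : Set (X × Y)} (hm : IsMultiplier μ ν m)
    (hmL : VanishesNear μ ν m L) (hF : F ∈ PhiZero μ ν K) : m * F ∈ PhiZero μ ν (K ∪ L) := by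
  obtain ⟨C, hC⟩ := id hm
  refine ⟨hm.mul_mem_Gamma hF.1, fun ε hε => ?_⟩
  have hpos : 0 < ε / (C + 1 : ℝ≥0) := ENNReal.div_pos hε.ne' ENNReal.coe_ne_top
  obtain ⟨G, ⟨hG, hGK⟩, hlt⟩ := hF.2 _ hpos
  refine ⟨m * G, ⟨hm.mul_mem_Gamma hG, (hGK.mul_left m).union (hmL.mul_right G)⟩, ?_⟩
  rw [← mul_sub]
  have h₁ : gammaNorm μ ν (m * (F - G)) ≤ (C + 1 : ℝ≥0) * gammaNorm μ ν (F - G) :=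
    (hC _ (sub_mem_Gamma hF.1 hG)).trans (by gcongr; exact le_self_add)
  refine h₁.trans_lt ?_
  rw [mul_comm]
  exact ENNReal.mul_lt_of_lt_div hlt

/-! ### Splitting along a Ditkin intersection -/

/-- On rectangles that exhaust `X × Y`, an elementary set `W` separates the part of `E₁` outside
a neighbourhood `U` of `E₁ ∩ E₂` from `E₂`. -/
theorem exists_separation [StandardBorelSpace X] [StandardBorelSpace Y] [SigmaFinite μ]
    [SigmaFinite ν] {E₁ E₂ U : Set (X × Y)} (hE₁ : PseudoClosed μ ν E₁)
    (hE₂ : PseudoClosed μ ν E₂) (hU : PseudoOpen μ ν U) (hEU : E₁ ∩ E₂ ⊆ U) :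
    ∃ (P : ℕ → Set X) (Q : ℕ → Set Y), (∀ k, MeasurableSet (P k)) ∧ (∀ k, MeasurableSet (Q k)) ∧
      Monotone P ∧ Monotone Q ∧ μ (⋃ k, P k)ᶜ = 0 ∧ ν (⋃ k, Q k)ᶜ = 0 ∧
      ∀ k, ∃ W, IsElementary μ ν W ∧ (∀ᶠ p in ae μ ×ˢ ae ν, p ∈ W → p ∉ E₂) ∧
        ∀ᶠ p in ae μ ×ˢ ae ν, p ∈ E₁ → p ∈ P k ×ˢ Q k → p ∈ U ∪ W := by
  obtain ⟨A, B, hA, hB, hAB⟩ := hU.exists_rectangles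
  obtain ⟨A₁, B₁, hA₁, hB₁, hAB₁⟩ := hE₁.exists_rectangles
  obtain ⟨A₂, B₂, hA₂, hB₂, hAB₂⟩ := hE₂.exists_rectangles
  have hcover : ∀ᶠ p in ae μ ×ˢ ae ν, ∃ i, p.1 ∈ Sum.elim A (Sum.elim A₁ A₂) i ∧
      p.2 ∈ Sum.elim B (Sum.elim B₁ B₂) i := by
    filter_upwards [hAB, hAB₁, hAB₂] with p h h₁ h₂
    simp only [Sum.exists, Sum.elim_inl, Sum.elim_inr, ← h, ← h₁, ← h₂, Set.mem_compl_iff]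
    by_cases hp₁ : p ∈ E₁
    · by_cases hp₂ : p ∈ E₂
      · exact Or.inl (hEU ⟨hp₁, hp₂⟩)
      · exact Or.inr (Or.inr hp₂)
    · exact Or.inr (Or.inl hp₁)
  obtain ⟨P, Q, hP, hQ, hPmono, hQmono, hPnull, hQnull, ht⟩ :=
    exists_exhaustion_finite_cover μ ν _ _
      (Sum.forall.2 ⟨hA, Sum.forall.2 ⟨hA₁, hA₂⟩⟩) (Sum.forall.2 ⟨hB, Sum.forall.2 ⟨hB₁, hB₂⟩⟩)
      hcover
  refine ⟨P, Q, hP, hQ, hPmono, hQmono, hPnull, hQnull, fun k => ?_⟩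
  obtain ⟨t, ht⟩ := ht k
  -- the rectangles of the finite cover that come from the complement of `E₂`
  refine ⟨⋃ n ∈ t.toRight.toRight, A₂ n ×ˢ B₂ n,
    .biUnion _ fun n => .prod (hA₂ n) (hB₂ n), ?_, ?_⟩
  · filter_upwards [hAB₂] with p h₂ hp
    obtain ⟨n, -, hn⟩ := Set.mem_iUnion₂.1 hp
    exact h₂.2 ⟨n, hn⟩
  · filter_upwards [hAB, hAB₁] with p h h₁ hp₁ hpk
    obtain ⟨i | i | i, hit, hi⟩ := ht p hpk
    · exact Or.inl (h.2 ⟨i, hi⟩)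
    · exact absurd hp₁ (h₁.2 ⟨i, hi⟩)
    · exact Or.inr (Set.mem_iUnion₂.2 ⟨i, by simpa using hit, hi⟩)

/-- An element of `Φ(E₁ ∩ E₂)`, where `E₁ ∩ E₂` is a Ditkin set, is approximated by sums
`m₁ F + m₂ F` whose multipliers vanish near `E₂` and near `E₁` respectively. -/
theorem Ditkin.exists_multipliers [StandardBorelSpace X] [StandardBorelSpace Y] [SigmaFinite μ]
    [SigmaFinite ν] {E₁ E₂ : Set (X × Y)} (hE₁ : PseudoClosed μ ν E₁)
    (hE₂ : PseudoClosed μ ν E₂) (hK : Ditkin μ ν (E₁ ∩ E₂)) {F : X × Y → ℂ}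
    (hF : F ∈ Phi μ ν (E₁ ∩ E₂)) {ε : ℝ≥0∞} (hε : 0 < ε) :
    ∃ m₁ m₂, IsMultiplier μ ν m₁ ∧ IsMultiplier μ ν m₂ ∧ VanishesNear μ ν m₁ E₂ ∧
      VanishesNear μ ν m₂ E₁ ∧ gammaNorm μ ν (F - (m₁ * F + m₂ * F)) < ε := by
  obtain ⟨g, hg, hlim⟩ := hK.2 F hF
  have hε' : 0 < ε / 2 := ENNReal.half_pos hε.ne'
  obtain ⟨n, hn⟩ := (hlim.eventually_lt_const hε').exists
  obtain ⟨hgV, U, hU, hEU, hgU⟩ := hg n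
  have hgm := IsMultiplier.of_mem_VInfty hgV
  have hgF := hgm.mul_mem_Gamma hF.1
  obtain ⟨P, Q, hP, hQ, hPmono, hQmono, hPnull, hQnull, hW⟩ := exists_separation hE₁ hE₂ hU hEU
  obtain ⟨k, hk⟩ := ((tendsto_gammaNorm_indicator_compl_mul hP hQ hPmono hQmono hPnull hQnull
    hgF).eventually_lt_const hε').exists
  obtain ⟨W, hWel, hWE₂, hWE₁⟩ := hW k
  set R := P k ×ˢ Q k with hR
  have hRel : IsElementary μ ν R := .prod (hP k) (hQ k)
  have h₁ := hRel.inter hWel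
  have h₂ := hRel.inter hWel.compl
  refine ⟨(R ∩ W).indicator 1 * g n, (R ∩ Wᶜ).indicator 1 * g n, h₁.isMultiplier.mul hgm,
    h₂.isMultiplier.mul hgm, ?_, ?_, ?_⟩
  · refine .of_ae_subset h₁.pseudoOpen_compl ?_ ?_
    · filter_upwards [hWE₂] with p hp hp₂ hpW using hp hpW.2 hp₂
    · exact vanishesOn_iff.2 (.of_forall fun p hp => by
        rw [Pi.mul_apply, Set.indicator_of_notMem hp, zero_mul])
  · refine .of_ae_subset (hU.union h₂.pseudoOpen_compl) ?_ ?_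
    · filter_upwards [hWE₁] with p hp hp₁
      by_contra hn
      rw [Set.mem_union, not_or, Set.notMem_compl_iff] at hn
      exact (hp hp₁ hn.2.1).elim hn.1 hn.2.2
    · rw [vanishesOn_iff] at hgU ⊢
      filter_upwards [hgU] with p hp hpU
      rcases hpU with hpU | hpU
      · rw [Pi.mul_apply, hp hpU, mul_zero]
      · rw [Pi.mul_apply, Set.indicator_of_notMem hpU, zero_mul]
  · have hsplit : g n * F - ((R ∩ W).indicator 1 * g n * F + (R ∩ Wᶜ).indicator 1 * g n * F) =
        Rᶜ.indicator 1 * (g n * F) := by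
      ext p
      by_cases hpR : p ∈ R <;> by_cases hpW : p ∈ W <;> simp [Set.indicator, hpR, hpW]
    refine (gammaNorm_sub_le F (g n * F) _).trans_lt ?_
    rw [hsplit, ← ENNReal.add_halves ε]
    exact ENNReal.add_lt_add ((gammaNorm_sub_comm_le (sub_mem_Gamma hgF hF.1)).trans_lt hn) hk

/-- For `F ∈ Φ₀(E₁) ∩ Φ₀(E₂)`, both terms of the approximation `m₁ F + m₂ F` are in
`Φ₀(E₁ ∪ E₂)`. -/
theorem Ditkin.PhiZero_union [StandardBorelSpace X] [StandardBorelSpace Y] [SigmaFinite μ]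
    [SigmaFinite ν] {E₁ E₂ : Set (X × Y)} (hE₁ : PseudoClosed μ ν E₁)
    (hE₂ : PseudoClosed μ ν E₂) (hK : Ditkin μ ν (E₁ ∩ E₂)) :
    PhiZero μ ν (E₁ ∪ E₂) = PhiZero μ ν E₁ ∩ PhiZero μ ν E₂ := by
  refine subset_antisymm (Set.subset_inter (PhiZero_anti Set.subset_union_left)
    (PhiZero_anti Set.subset_union_right)) ?_
  rintro F ⟨hF₁, hF₂⟩
  have hF : F ∈ Phi μ ν (E₁ ∩ E₂) :=
    PhiZero_subset_Phi _ (PhiZero_anti Set.inter_subset_left hF₁)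
  refine mem_PhiZero_of_approx hF.1 fun ε hε => ?_
  obtain ⟨m₁, m₂, hm₁, hm₂, hmE₂, hmE₁, hlt⟩ := hK.exists_multipliers hE₁ hE₂ hF hε
  refine ⟨_, add_mem_PhiZero (mul_mem_PhiZero_union hm₁ hmE₂ hF₁) ?_, hlt⟩
  rw [Set.union_comm]
  exact mul_mem_PhiZero_union hm₂ hmE₁ hF₂

/-- If the union is synthetic, so is each of the two sets: `m₁ F` vanishes on both sets and
`m₂ F` vanishes near `E₁`. -/
theorem Ditkin.synthetic_left [StandardBorelSpace X] [StandardBorelSpace Y] [SigmaFinite μ]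
    [SigmaFinite ν] {E₁ E₂ : Set (X × Y)} (hE₁ : PseudoClosed μ ν E₁)
    (hE₂ : PseudoClosed μ ν E₂) (hK : Ditkin μ ν (E₁ ∩ E₂))
    (h : Synthetic μ ν (E₁ ∪ E₂)) : Synthetic μ ν E₁ := by
  refine ⟨hE₁, subset_antisymm (PhiZero_subset_Phi _) ?_⟩
  intro F hF
  have hFK : F ∈ Phi μ ν (E₁ ∩ E₂) :=
    ⟨hF.1, vanishesOn_iff.2 ((vanishesOn_iff.1 hF.2).mono fun p hp hpK => hp hpK.1)⟩
  refine mem_PhiZero_of_approx hF.1 fun ε hε => ?_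
  obtain ⟨m₁, m₂, hm₁, hm₂, hmE₂, hmE₁, hlt⟩ := hK.exists_multipliers hE₁ hE₂ hFK hε
  refine ⟨_, add_mem_PhiZero ?_ (mem_PhiZero_of_vanishesNear (hm₂.mul_mem_Gamma hF.1)
    (hmE₁.mul_right F)), hlt⟩
  refine PhiZero_anti (Set.subset_union_left (t := E₂)) ?_
  rw [h.2, Phi_union]
  exact ⟨⟨hm₁.mul_mem_Gamma hF.1, mul_comm F m₁ ▸ hF.2.mul_right m₁⟩,
    hm₁.mul_mem_Gamma hF.1, hmE₂.vanishesOn.mul_right F⟩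

end OpSynth

theorem mainTheorem12 {X Y : Type*} [MeasurableSpace X] [StandardBorelSpace X]
    [MeasurableSpace Y] [StandardBorelSpace Y]
    (μ : Measure X) [SigmaFinite μ] (ν : Measure Y) [SigmaFinite ν]
    (E₁ E₂ : Set (X × Y))
    (hE₁ : OpSynth.PseudoClosed μ ν E₁) (hE₂ : OpSynth.PseudoClosed μ ν E₂)
    (hK : OpSynth.Ditkin μ ν (E₁ ∩ E₂)) :
    (OpSynth.Synthetic μ ν (E₁ ∪ E₂) ↔
      OpSynth.Synthetic μ ν E₁ ∧ OpSynth.Synthetic μ ν E₂) ∧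
    OpSynth.PhiZero μ ν (E₁ ∪ E₂) = OpSynth.PhiZero μ ν E₁ ∩ OpSynth.PhiZero μ ν E₂ := by
  have hunion := hK.PhiZero_union hE₁ hE₂
  refine ⟨⟨fun h => ⟨hK.synthetic_left hE₁ hE₂ h, ?_⟩, fun h => ⟨hE₁.union hE₂, ?_⟩⟩, hunion⟩
  · rw [Set.inter_comm] at hK
    rw [Set.union_comm] at h
    exact hK.synthetic_left hE₂ hE₁ h
  · rw [hunion, h.1.2, h.2.2, OpSynth.Phi_union]
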